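/- Let $H$ be a real Hilbert space. Write $\Gamma_0(H)$ for the set of proper (i.e. not identically $+\infty$), lower semicontinuous, convex functions $H\to\mathbb R\cup\{+\infty\}$, and $\mathcal A(H)$ for the set of maps $A:H\to H$ that are Lipschitz continuous and strongly monotone (there is $\alpha>0$ with $\langle A(x_2)-A(x_1),x_2-x_1\rangle\ge\alpha\|x_2-x_1\|^2$ for all $x_1,x_2\in H$). *Definitions.* For a family $(S_\tau)_{\tau>0}$ of subsets of a Hilbert space, let $\liminf S_\tau$ be the set of points $x$ such that for every sequence $t_n>0$, $t_n\to0$, there are $x_n\to x$ (strongly) with $x_n\in S_{t_n}$ for all large $n$; let $\text{w-}\limsup S_\tau$ be the set of points $x$ for which there exist a sequence $t_n>0$, $t_n\to0$, and points $x_n\in S_{t_n}$ with $x_n\rightharpoonup x$ (weakly). The family is M-convergent (Mosco convergent) if $\text{w-}\limsup S_\tau\subset\liminf S_\tau$, and then $\liminf S_\tau$ is its M-limit. A family of functions $F_\tau:H\to\mathbb R\cup\{\pm\infty\}$, $\tau>0$, is M-convergent if the epigraphs $\{(x,\lambda)\in H\times\mathbb R: F_\tau(x)\le\lambda\}$ are;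 its M-limit is the function whose epigraph is the M-limit of these epigraphs. Let $f:\mathbb R_+\times H\to\mathbb R\cup\{+\infty\}$ with $f(t,\cdot)\in\Gamma_0(H)$ for all $t\ge0$, let $x\in H$ with $f(t,x)\in\mathbb R$ for all $t\ge0$, and let $v\in\partial f(0,x)$, the convex subdifferential of $f(0,\cdot)$ at $x$. Then $f$ is twice epi-differentiable at $x$ for $v$ if the functions $$\Delta^2_\tau f(x|v)(w)=\frac{f(\tau,x+\tau w)-f(\tau,x)-\tau\langle v,w\rangle}{\tau^2},\qquad w\in H,$$ M-converge as $\tau\to0$; the M-limit $d^2_ef(x|v):H\to\mathbb R\cup\{\pm\infty\}$ is the second epi-derivative. **Proposition.** Let $f:\mathbb R_+\times H\to\mathbb R\cup\{+\infty\}$ with $f(t,\cdot)\in\Gamma_0(H)$ for all $t\ge0$, let $\ell:\mathbb R_+\to H$, and let $g:\mathbb R_+\times H\to\mathbb R$ be such that, for all $t\ge0$, $g(t,\cdot)$ is differentiable on $H$ and $\nabla_xg(t,\cdot)\in\mathcal A(H)$. Then, for every $t\ge0$, the problem $$\operatorname*{argmin}_{x\in H}\big[f(t,x)+g(t,x)-\langle\ell(t),x\rangle\big]$$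 has a unique solution, denoted $y(t)$, and $v_0:=\ell(0)-\nabla_xg(0,y(0))$ belongs to $\partial f(0,y(0))$. If moreover 1. $\ell$ is differentiable at $t=0$ (from the right); 2. $\nabla_xg(t,\cdot)$, $t\ge0$, are Lipschitz continuous and strongly monotone with constants independent of $t$; 3. $\nabla_xg$ is of class $C^1$ on $\mathbb R_+\times H$; 4. $f$ is twice epi-differentiable at $y(0)$ for $v_0$ (in particular $f(t,y(0))\in\mathbb R$ for all $t\ge0$); 5. $d^2_ef(y(0)|v_0)\in\Gamma_0(H)$; then $y:\mathbb R_+\to H$ is differentiable at $t=0$ (from the right), and $y'(0)$ is the unique solution of $$\operatorname*{argmin}_{x\in H}\Big[d^2_ef(y(0)|v_0)(x)+\tfrac12\langle\nabla^2_{xx}g(0,y(0))(x),x\rangle+\langle\nabla^2_{tx}g(0,y(0))-\ell'(0),x\rangle\Big],$$ where $\nabla^2_{xx}g(0,y(0))$ is the derivative of $\nabla_xg(0,\cdot)$ at $y(0)$ and $\nabla^2_{tx}g(0,y(0))$ is the (right) derivative of $t\mapsto\nabla_xg(t,y(0))$ at $t=0$. -/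

import Mathlib

open Set Filter Topology
open scoped NNReal

noncomputable section

namespace ParamConvex

section SetLimits

variable {E : Type*} [NormedAddCommGroup E] [NormedSpace ℝ E]

/-- A sequence of positive parameters converging to `0`. -/
def PosTendstoZero (t : ℕ → ℝ) : Prop :=
  (∀ n, 0 < t n) ∧ Tendsto t atTop (𝓝 0)

/-- Weak convergence of a sequence in a normed space. -/
def WeakTendsto (u : ℕ → E) (x : E) : Prop :=
  Tendsto (fun n => toWeakSpace ℝ E (u n)) atTop (𝓝 (toWeakSpace ℝ E x))

/-- The weak-outer limit, as `τ → 0`, of a family `(S τ)` of sets indexed by `τ > 0`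
(the values `S τ` for `τ ≤ 0` play no role). -/
def weakOuterLimit (S : ℝ → Set E) : Set E :=
  {x | ∃ t : ℕ → ℝ, PosTendstoZero t ∧ ∃ u : ℕ → E, WeakTendsto u x ∧ ∀ n, u n ∈ S (t n)}

/-- The (strong) inner limit, as `τ → 0`, of a family `(S τ)` of sets indexed by `τ > 0`. -/
def innerLimit (S : ℝ → Set E) : Set E :=
  {x | ∀ t : ℕ → ℝ, PosTendstoZero t →
    ∃ u : ℕ → E, Tendsto u atTop (𝓝 x) ∧ ∃ N : ℕ, ∀ n ≥ N, u n ∈ S (t n)}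

/-- Mosco convergence of a family of sets; the Mosco limit is then `innerLimit S`. -/
def MoscoConvergent (S : ℝ → Set E) : Prop :=
  weakOuterLimit S ⊆ innerLimit S

end SetLimits

lemma mem_innerLimit_of_approx {E : Type*} [NormedAddCommGroup E] {S : ℝ → Set E} {x : E}
    (h : ∀ ε > 0, ∃ y ∈ innerLimit S, dist y x < ε) : x ∈ innerLimit S := by
  intro t ht
  have key : ∀ ε > 0, ∀ᶠ n in atTop, ∃ z ∈ S (t n), dist z x < ε := by
    intro ε hε
    obtain ⟨y, hy, hyx⟩ := h (ε / 2) (by positivity)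
    obtain ⟨u, hu, N, hN⟩ := hy t ht
    filter_upwards [(Metric.tendsto_nhds.1 hu) (ε / 2) (by positivity), eventually_ge_atTop N]
      with n hn hNn
    exact ⟨u n, hN n hNn, by linarith [dist_triangle (u n) y x]⟩
  have near : ∀ n, ∃ z, (S (t n)).Nonempty →
      z ∈ S (t n) ∧ dist x z < Metric.infDist x (S (t n)) + 1 / ((n : ℝ) + 1) := by
    intro n
    by_cases hne : (S (t n)).Nonempty
    · obtain ⟨z, hz, hd⟩ := (Metric.infDist_lt_iff hne).1
        (lt_add_of_pos_right (Metric.infDist x (S (t n))) (Nat.one_div_pos_of_nat (n := n)))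
      exact ⟨z, fun _ => ⟨hz, hd⟩⟩
    · exact ⟨x, fun h' => absurd h' hne⟩
  choose u hu using near
  refine ⟨u, ?_, ?_⟩
  · rw [Metric.tendsto_nhds]
    intro ε hε
    have h1 := (tendsto_one_div_add_atTop_nhds_zero_nat (𝕜 := ℝ)).eventually_lt_const
      (half_pos hε)
    filter_upwards [key (ε / 2) (by positivity), h1] with n ⟨z, hz, hd⟩ h1
    have := (hu n ⟨z, hz⟩).2
    have := Metric.infDist_le_dist_of_mem (x := x) hz
    rw [dist_comm] at hd
    rw [dist_comm]
    linarith
  · obtain ⟨N, hN⟩ := eventually_atTop.1 (key 1 one_pos)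
    refine ⟨N, fun n hn => ?_⟩
    obtain ⟨z, hz, -⟩ := hN n hn
    exact (hu n ⟨z, hz⟩).1

section Functions

variable {H : Type*} [NormedAddCommGroup H] [InnerProductSpace ℝ H]

/-- The epigraph of an extended-real-valued function, a subset of `H × ℝ`. -/
def epi (f : H → EReal) : Set (H × ℝ) :=
  {p | f p.1 ≤ (p.2 : EReal)}

/-- `Γ₀(H)`: proper, lower semicontinuous, convex functions `H → ℝ ∪ {+∞}`. -/
structure IsGammaZero (f : H → EReal) : Prop where
  ne_bot : ∀ x, f x ≠ ⊥
  proper : ∃ x, f x ≠ ⊤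
  lsc : IsClosed (epi f)
  convex : Convex ℝ (epi f)

/-- The subdifferential of `f` at `x`. -/
def subdifferential (f : H → EReal) (x : H) : Set H :=
  {v | ∀ z, ((inner ℝ v (z - x) : ℝ) : EReal) ≤ f z - f x}

/-- The set of global minimizers of `F`. -/
def argmin (F : H → EReal) : Set H :=
  {x | ∀ z, F x ≤ F z}

/-- Lipschitz continuous and strongly monotone single-valued maps `H → H`. -/
def IsLipStrongMono (A : H → H) : Prop :=
  (∃ M : ℝ≥0, LipschitzWith M A) ∧
  ∃ α : ℝ, 0 < α ∧ ∀ x₁ x₂, α * ‖x₂ - x₁‖ ^ 2 ≤ inner ℝ (A x₂ - A x₁) (x₂ - x₁)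

/-- Parameterized maps `A (t, ·)`, `t ≥ 0`, which are Lipschitz continuous and strongly monotone
with constants independent of `t`. -/
def IsUnifLipStrongMono (A : ℝ → H → H) : Prop :=
  (∃ M : ℝ≥0, ∀ t, 0 ≤ t → LipschitzWith M (A t)) ∧
  ∃ α : ℝ, 0 < α ∧ ∀ t, 0 ≤ t → ∀ x₁ x₂,
    α * ‖x₂ - x₁‖ ^ 2 ≤ inner ℝ (A t x₂ - A t x₁) (x₂ - x₁)

/-- Mosco convergence, as `τ → 0`, of a family `(F τ)`, `τ > 0`, of extended-real-valued
functions. -/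
def MConvergent (F : ℝ → H → EReal) : Prop :=
  MoscoConvergent (fun τ => epi (F τ))

/-- The function whose epigraph is the inner limit of the epigraphs of `F τ`
(see `epi_epiLimit`). If `F` is `MConvergent`, this is its M-limit. -/
def epiLimit (F : ℝ → H → EReal) (x : H) : EReal :=
  ⨅ (r : ℝ) (_ : (x, r) ∈ innerLimit (fun τ => epi (F τ))), (r : EReal)

/-- The second-order difference quotient
`w ↦ (f (τ, x + τ w) - f (τ, x) - τ ⟨v, w⟩) / τ ^ 2`. -/
def secondQuotient (f : ℝ → H → EReal) (x v : H) (τ : ℝ) (w : H) : EReal :=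
  (f τ (x + τ • w) - f τ x - ((τ * inner ℝ v w : ℝ) : EReal)) / ((τ ^ 2 : ℝ) : EReal)

/-- Twice epi-differentiability at `x` for `v` of a function `f (t, ·)` depending on `t ≥ 0`: here
`f (t, x)` is finite for all `t ≥ 0`, `v` is a subgradient of `f (0, ·)` at `x`, and the
second-order difference quotients M-converge as `τ → 0`. -/
structure TwiceEpiDifferentiableAt (f : ℝ → H → EReal) (x v : H) : Prop where
  finite : ∀ t, 0 ≤ t → f t x ≠ ⊥ ∧ f t x ≠ ⊤
  subgradient : v ∈ subdifferential (f 0) x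
  mconvergent : MConvergent (secondQuotient f x v)

/-- The second epi-derivative of `f` at `x` for `v`. -/
def secondEpiDeriv (f : ℝ → H → EReal) (x v : H) : H → EReal :=
  epiLimit (secondQuotient f x v)

/-- The characterization of `epiLimit` by its epigraph. -/
theorem epi_epiLimit (F : ℝ → H → EReal) :
    epi (epiLimit F) = innerLimit (fun τ => epi (F τ)) := by
  ext ⟨x, r⟩
  constructor
  · intro h
    refine mem_innerLimit_of_approx fun ε hε => ?_
    have hlt : epiLimit F x < ((r + ε / 2 : ℝ) : EReal) :=
      lt_of_le_of_lt h (by exact_mod_cast (by linarith : r < r + ε / 2))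
    simp only [epiLimit, iInf_lt_iff] at hlt
    obtain ⟨s, hs, hsr⟩ := hlt
    have hsr' : s < r + ε / 2 := by exact_mod_cast hsr
    refine ⟨(x, r + ε / 2), fun t ht => ?_, ?_⟩
    · obtain ⟨u, hu, N, hN⟩ := hs t ht
      refine ⟨fun n => ((u n).1, (u n).2 + (r + ε / 2 - s)), ?_, N, fun n hn => ?_⟩
      · have h2 := (continuous_snd.tendsto (x, s)).comp hu
        have h3 := h2.add_const (r + ε / 2 - s)
        have h4 : s + (r + ε / 2 - s) = r + ε / 2 := by ring
        simp only [h4] at h3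
        exact ((continuous_fst.tendsto (x, s)).comp hu).prodMk_nhds h3
      · have h5 : F (t n) (u n).1 ≤ ((u n).2 : EReal) := hN n hn
        refine le_trans h5 ?_
        have : (u n).2 ≤ (u n).2 + (r + ε / 2 - s) := by linarith
        exact_mod_cast this
    · simp [Prod.dist_eq, abs_of_pos hε, hε]
  · intro h
    exact iInf₂_le (f := fun (s : ℝ) (_ : (x, s) ∈ innerLimit (fun τ => epi (F τ))) => (s : EReal)) r h

end Functions

end ParamConvex

end

open ParamConvex

namespace ParamConvex

/-! ### Minimisers of a `Γ₀` function plus a differentiable, strongly convex one. -/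

section Minimizers

variable {H : Type*} [NormedAddCommGroup H] [InnerProductSpace ℝ H]

/-! Each `y t` satisfies a variational inequality over the epigraph of `f t`, governed by `∇g(t,·) -
ℓ t` (`argmin_variational`). Substituting `z = y 0 + t w` and dividing by `t ^ 2` shows that `(y t -
y 0) / t` satisfies the same kind of inequality over the epigraph of the second-order quotient,
governed by `w ↦ (∇g(t, y 0 + t w) + v - ℓ t) / t`. These maps keep the modulus of strong
monotonicity `α`, and along `w → w₀` their values converge to the gradient at `w₀` of the smooth
part of the limit problem.

Differentiability of `y` is thus stability of variational inequalities under Mosco convergence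
(`tendsto_of_moscoConvergent`). That lemma needs no a priori bound on the difference quotients: if
they stay away from a recovery sequence for `w₀`, a step of length at most one towards them, taken
inside the convex epigraphs, has a weak limit violating the limit inequality. The limit problem is
solvable by the argument that provides `y` (`existsUnique_argmin`). -/

lemma mem_epi {X : Type*} {f : X → EReal} {x : X} {r : ℝ} : (x, r) ∈ epi f ↔ f x ≤ (r : EReal) := Iff.rfl

lemma epi_mono {X : Type*} {f : X → EReal} {x : X} {r s : ℝ} (h : (x, r) ∈ epi f) (hrs : r ≤ s) :
    (x, s) ∈ epi f :=
  le_trans (mem_epi.1 h) (by exact_mod_cast hrs)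

/-- A finite value of an extended-real-valued function, as a real number. -/
lemma IsGammaZero.exists_real {f : H → EReal} (hf : IsGammaZero f) {x : H} (hx : f x ≠ ⊤) :
    ∃ a : ℝ, f x = a :=
  ⟨(f x).toReal, (EReal.coe_toReal hx (hf.ne_bot x)).symm⟩

/-- A convex function in terms of combinations of points of its epigraph. -/
lemma convex_epi_combo {C : Set (H × ℝ)} (hC : Convex ℝ C) {x z : H} {r s : ℝ}
    (hx : (x, r) ∈ C) (hz : (z, s) ∈ C) {c : ℝ} (hc0 : 0 ≤ c) (hc1 : c ≤ 1) :
    (x + c • (z - x), (1 - c) * r + c * s) ∈ C := by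
  have h := hC hx hz (sub_nonneg.2 hc1) hc0 (by ring)
  have e : (1 - c) • (x, r) + c • (z, s) = (x + c • (z - x), (1 - c) * r + c * s) := by
    ext
    · simp only [Prod.fst_add, Prod.smul_fst]
      module
    · simp
  rwa [e] at h

/-- Strong monotonicity with modulus `α`. -/
def StrongMonoWith (α : ℝ) (A : H → H) : Prop :=
  ∀ x₁ x₂, α * ‖x₂ - x₁‖ ^ 2 ≤ inner ℝ (A x₂ - A x₁) (x₂ - x₁)

/-- A function of `Γ₀(H)` is bounded below by a function which grows linearly. -/
lemma IsGammaZero.exists_linear_lower_bound {φ : H → EReal} (hφ : IsGammaZero φ) :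
    ∃ (x₀ : H) (b k : ℝ), ∀ z r, (z, r) ∈ epi φ → b - k * ‖z - x₀‖ ≤ r := by
  obtain ⟨x₀, hx₀⟩ := hφ.proper
  obtain ⟨c, hc⟩ := hφ.exists_real hx₀
  have hnot : (x₀, c - 1) ∈ (epi φ)ᶜ := by
    intro h
    rw [mem_epi, hc] at h
    have : c ≤ c - 1 := by exact_mod_cast h
    linarith
  obtain ⟨ρ, hρ, hball⟩ := Metric.isOpen_iff.1 hφ.lsc.isOpen_compl _ hnot
  have hlow : ∀ z r, (z, r) ∈ epi φ → ‖z - x₀‖ < ρ → c - 1 < r := by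
    intro z r hz hzρ
    by_contra! hle
    refine hball (a := (z, c - 1)) ?_ (epi_mono hz hle)
    simpa [Prod.dist_eq, dist_eq_norm, hρ] using hzρ
  -- Away from `x₀`, shrink to the point of the segment at distance `ρ / 2`, where the bound `c - 1`
  -- holds; convexity extrapolates it with slope `2 / ρ`.
  refine ⟨x₀, c - 1, 2 / ρ, fun z r hz => ?_⟩
  rcases lt_or_ge ‖z - x₀‖ ρ with hlt | hge
  · have := hlow z r hz hlt
    have : 0 ≤ 2 / ρ * ‖z - x₀‖ := by positivity
    linarith
  · have hd : 0 < ‖z - x₀‖ := hρ.trans_le hge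
    set s := ρ / (2 * ‖z - x₀‖) with hs
    have hs0 : 0 < s := by positivity
    have hs1 : s ≤ 1 := by
      rw [hs, div_le_one (by positivity)]
      linarith
    have hsd : s * ‖z - x₀‖ = ρ / 2 := by
      rw [hs]
      field_simp
    have h1 := hlow _ _ (convex_epi_combo hφ.convex (mem_epi.2 hc.le) hz hs0.le hs1) (by
      rw [add_sub_cancel_left, norm_smul, Real.norm_eq_abs, abs_of_pos hs0, hsd]
      linarith)
    have h2 : s * (2 / ρ * ‖z - x₀‖) = 1 := by
      rw [mul_left_comm, hsd]
      field_simp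
    have h3 : s * (c - 2 / ρ * ‖z - x₀‖) ≤ s * r := by linarith
    linarith [le_of_mul_le_mul_left h3 hs0]

variable [CompleteSpace H]

lemma hasDerivAt_line {h : H → ℝ} {A : H → H} (hh : ∀ x, HasGradientAt h (A x) x) (x d : H)
    (s : ℝ) : HasDerivAt (fun s : ℝ => h (x + s • d)) (inner ℝ (A (x + s • d)) d) s := by
  have h1 : HasDerivAt (fun s : ℝ => x + s • d) d s := by
    simpa using ((hasDerivAt_id s).smul_const d).const_add x
  have h2 := (hh (x + s • d)).hasFDerivAt.comp_hasDerivAt s h1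
  exact h2.congr_deriv (by simp)

/-- The quadratic lower bound given by a strongly monotone gradient. -/
lemma StrongMonoWith.tangent_le {h : H → ℝ} {A : H → H} {α : ℝ}
    (hh : ∀ x, HasGradientAt h (A x) x) (hA : StrongMonoWith α A) (x z : H) :
    h x + inner ℝ (A x) (z - x) + α / 2 * ‖z - x‖ ^ 2 ≤ h z := by
  set d := z - x with hd
  have hder : ∀ s : ℝ, HasDerivAt
      (fun s : ℝ => h (x + s • d) - s * inner ℝ (A x) d - α / 2 * ‖d‖ ^ 2 * s ^ 2)
      (inner ℝ (A (x + s • d)) d - inner ℝ (A x) d - α * ‖d‖ ^ 2 * s) s := by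
    intro s
    have h1 := ((hasDerivAt_line hh x d s).sub ((hasDerivAt_id s).mul_const (inner ℝ (A x) d))).sub
      ((hasDerivAt_pow 2 s).const_mul (α / 2 * ‖d‖ ^ 2))
    refine h1.congr_deriv ?_
    simp only [one_mul, Nat.cast_ofNat, Nat.add_one_sub_one, pow_one]
    ring
  -- Strong monotonicity between `x` and `x + s • d`, divided by `s`, makes this derivative
  -- nonnegative.
  have hmono : MonotoneOn
      (fun s : ℝ => h (x + s • d) - s * inner ℝ (A x) d - α / 2 * ‖d‖ ^ 2 * s ^ 2) (Icc 0 1) := by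
    refine monotoneOn_of_deriv_nonneg (convex_Icc 0 1)
      (fun s _ => (hder s).continuousAt.continuousWithinAt)
      (fun s _ => (hder s).differentiableAt.differentiableWithinAt) fun s hs => ?_
    rw [interior_Icc] at hs
    rw [(hder s).deriv]
    have h2 := hA x (x + s • d)
    simp only [add_sub_cancel_left, norm_smul, inner_smul_right, inner_sub_left, mul_pow,
      Real.norm_eq_abs, sq_abs] at h2
    have h3 : s * (α * ‖d‖ ^ 2 * s) ≤ s * (inner ℝ (A (x + s • d)) d - inner ℝ (A x) d) := by
      linarith
    linarith [le_of_mul_le_mul_left h3 hs.1]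
  have h4 := hmono (left_mem_Icc.2 zero_le_one) (right_mem_Icc.2 zero_le_one) zero_le_one
  simp only [zero_smul, one_smul, add_zero] at h4
  have h5 : x + d = z := by simp [hd]
  rw [h5] at h4
  linarith

/-- The strong midpoint convexity given by a strongly monotone gradient. -/
lemma StrongMonoWith.midpoint_le {h : H → ℝ} {A : H → H} {α : ℝ}
    (hh : ∀ x, HasGradientAt h (A x) x) (hA : StrongMonoWith α A) (x z : H) :
    h (x + (1 / 2 : ℝ) • (z - x)) + α / 8 * ‖z - x‖ ^ 2 ≤ (h x + h z) / 2 := by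
  set m := x + (1 / 2 : ℝ) • (z - x) with hm
  have h1 := hA.tangent_le hh m x
  have h2 := hA.tangent_le hh m z
  have e1 : x - m = (-(1 / 2) : ℝ) • (z - x) := by rw [hm]; module
  have e2 : z - m = (1 / 2 : ℝ) • (z - x) := by rw [hm]; module
  rw [e1] at h1
  rw [e2] at h2
  simp only [norm_smul, inner_smul_right, mul_pow, norm_neg] at h1 h2
  norm_num at h1 h2
  linarith

/-- First-order optimality condition for the sum of a convex and a differentiable function. -/
lemma argmin_variational {φ : H → EReal} (hφ : IsGammaZero φ) {h : H → ℝ} {A : H → H}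
    (hh : ∀ x, HasGradientAt h (A x) x) {x : H} (hx : x ∈ argmin (fun x => φ x + (h x : EReal))) :
    ∃ a : ℝ, φ x = a ∧ ∀ z r, (z, r) ∈ epi φ → a - inner ℝ (A x) (z - x) ≤ r := by
  obtain ⟨x₀, hx₀⟩ := hφ.proper
  obtain ⟨c, hc⟩ := hφ.exists_real hx₀
  have hxt : φ x ≠ ⊤ := by
    intro htop
    have h1 := hx x₀
    simp only [htop, hc, EReal.top_add_coe] at h1
    rw [← EReal.coe_add] at h1
    exact (EReal.coe_ne_top _) (top_le_iff.1 h1)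
  obtain ⟨a, ha⟩ := hφ.exists_real hxt
  refine ⟨a, ha, fun z r hz => ?_⟩
  -- Compare `x` with a point a fraction `s` of the way to `z`, divide by `s`, then let `s → 0⁺`.
  have key : ∀ s ∈ Ioc (0 : ℝ) 1,
      -(r - a) ≤ s⁻¹ * (h (x + s • (z - x)) - h x) := by
    intro s hs
    have h1 := convex_epi_combo hφ.convex (mem_epi.2 ha.le) hz hs.1.le hs.2
    have h2 := (hx (x + s • (z - x))).trans (add_le_add_left (mem_epi.1 h1) _)
    simp only [ha] at h2
    have h3 : a + h x ≤ (1 - s) * a + s * r + h (x + s • (z - x)) := by exact_mod_cast h2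
    rw [inv_mul_eq_div, le_div_iff₀ hs.1]
    linarith
  have hd := (hasDerivAt_line hh x (z - x) 0).tendsto_slope_zero_right
  simp only [zero_add, zero_smul, add_zero, smul_eq_mul] at hd
  have h4 : -(r - a) ≤ inner ℝ (A x) (z - x) := by
    refine ge_of_tendsto hd ?_
    filter_upwards [Ioc_mem_nhdsGT (zero_lt_one' ℝ)] with s hs using key s hs
  linarith

/-- Testing each variational inequality at the other minimiser and adding contradicts strong
monotonicity unless the two coincide. -/
lemma argmin_unique {φ : H → EReal} (hφ : IsGammaZero φ) {h : H → ℝ} {A : H → H} {α : ℝ}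
    (hα : 0 < α) (hh : ∀ x, HasGradientAt h (A x) x) (hA : StrongMonoWith α A) {x z : H}
    (hx : x ∈ argmin (fun x => φ x + (h x : EReal)))
    (hz : z ∈ argmin (fun x => φ x + (h x : EReal))) : x = z := by
  obtain ⟨a, ha, hxa⟩ := argmin_variational hφ hh hx
  obtain ⟨b, hb, hzb⟩ := argmin_variational hφ hh hz
  have h1 := hxa z b (mem_epi.2 hb.le)
  have h2 := hzb x a (mem_epi.2 ha.le)
  have h3 := hA z x
  rw [← neg_sub x z, inner_neg_right] at h1
  rw [inner_sub_left] at h3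
  have h4 : ‖x - z‖ ^ 2 ≤ 0 := by
    by_contra! hlt
    nlinarith
  have h5 : ‖x - z‖ = 0 := by
    have := sq_nonneg ‖x - z‖
    exact pow_eq_zero_iff two_ne_zero |>.1 (le_antisymm h4 this)
  exact sub_eq_zero.1 (norm_eq_zero.1 h5)

/-- Strong midpoint convexity makes minimising sequences Cauchy, so completeness suffices and no
weak compactness is needed. Working with points of the epigraph keeps the infimum real. -/
lemma argmin_nonempty {φ : H → EReal} (hφ : IsGammaZero φ) {h : H → ℝ} {A : H → H} {α : ℝ}
    (hα : 0 < α) (hh : ∀ x, HasGradientAt h (A x) x) (hA : StrongMonoWith α A) :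
    (argmin (fun x => φ x + (h x : EReal))).Nonempty := by
  obtain ⟨x₀, b, k, hlow⟩ := hφ.exists_linear_lower_bound
  set V : Set ℝ := (fun p : H × ℝ => p.2 + h p.1) '' epi φ with hV
  have hbdd : BddBelow V := by
    -- The minimum over `‖z - x₀‖` of the quadratic lower bound, by completing the square.
    refine ⟨b + h x₀ - (k + ‖A x₀‖) ^ 2 / (2 * α), ?_⟩
    rintro _ ⟨⟨z, r⟩, hz, rfl⟩
    have h1 := hlow z r hz
    have h2 := hA.tangent_le hh x₀ z
    have h3 := neg_le_of_abs_le (abs_real_inner_le_norm (A x₀) (z - x₀))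
    have h4 : 0 ≤ (α * ‖z - x₀‖ - (k + ‖A x₀‖)) ^ 2 / (2 * α) := by positivity
    have h5 : (α * ‖z - x₀‖ - (k + ‖A x₀‖)) ^ 2 / (2 * α) =
        α / 2 * ‖z - x₀‖ ^ 2 - (k + ‖A x₀‖) * ‖z - x₀‖ + (k + ‖A x₀‖) ^ 2 / (2 * α) := by
      field_simp
      ring
    simp only
    linarith
  have hne : V.Nonempty := by
    obtain ⟨x, hx⟩ := hφ.proper
    obtain ⟨c, hc⟩ := hφ.exists_real hx
    exact ⟨_, (x, c), mem_epi.2 hc.le, rfl⟩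
  set m := sInf V with hm
  have hle : ∀ z r, (z, r) ∈ epi φ → m ≤ r + h z := fun z r hz => csInf_le hbdd ⟨(z, r), hz, rfl⟩
  have hex : ∀ n : ℕ, ∃ p ∈ epi φ, p.2 + h p.1 < m + 1 / ((n : ℝ) + 1) := by
    intro n
    obtain ⟨_, ⟨p, hp, rfl⟩, hlt⟩ := exists_lt_of_csInf_lt hne
      (lt_add_of_pos_right m (Nat.one_div_pos_of_nat (n := n) (α := ℝ)))
    exact ⟨p, hp, hlt⟩
  choose p hp hpm using hex
  -- The midpoint has value at least `m`, so two almost minimal points must be close.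
  have hpair : ∀ i j : ℕ, α / 8 * ‖(p j).1 - (p i).1‖ ^ 2 ≤
      (1 / ((i : ℝ) + 1) + 1 / ((j : ℝ) + 1)) / 2 := by
    intro i j
    have h1 := hA.midpoint_le hh (p i).1 (p j).1
    have h2 := hle _ _ (convex_epi_combo hφ.convex (hp i) (hp j) (c := 1 / 2) (by norm_num)
      (by norm_num))
    have h3 := hpm i
    have h4 := hpm j
    linarith
  have hcau : CauchySeq (fun n => (p n).1) := by
    rw [Metric.cauchySeq_iff']
    intro ε hε
    obtain ⟨N, hN⟩ := exists_nat_one_div_lt (show 0 < α / 8 * ε ^ 2 by positivity)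
    refine ⟨N, fun n hn => ?_⟩
    have h1 := hpair N n
    have h2 : 1 / ((n : ℝ) + 1) ≤ 1 / ((N : ℝ) + 1) := Nat.one_div_le_one_div hn
    have h3 : α / 8 * ‖(p n).1 - (p N).1‖ ^ 2 < α / 8 * ε ^ 2 := by linarith
    rw [dist_eq_norm]
    exact lt_of_pow_lt_pow_left₀ 2 hε.le (lt_of_mul_lt_mul_left h3 (by positivity))
  obtain ⟨x, hx⟩ := cauchySeq_tendsto_of_complete hcau
  have hhx : Tendsto (fun n => h (p n).1) atTop (𝓝 (h x)) :=
    ((hh x).hasFDerivAt.continuousAt.tendsto).comp hx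
  have hsum : Tendsto (fun n => (p n).2 + h (p n).1) atTop (𝓝 m) := by
    have hup : Tendsto (fun n : ℕ => m + 1 / ((n : ℝ) + 1)) atTop (𝓝 m) := by
      simpa using tendsto_one_div_add_atTop_nhds_zero_nat.const_add m
    exact tendsto_of_tendsto_of_tendsto_of_le_of_le tendsto_const_nhds hup
      (fun n => hle _ _ (hp n)) (fun n => (hpm n).le)
  have h2 : Tendsto (fun n => (p n).2) atTop (𝓝 (m - h x)) := by
    simpa using hsum.sub hhx
  have hmem : (x, m - h x) ∈ epi φ :=
    hφ.lsc.mem_of_tendsto (hx.prodMk_nhds h2) (Eventually.of_forall hp)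
  refine ⟨x, fun z => ?_⟩
  have h5 : φ x + (h x : EReal) ≤ (m : EReal) := by
    refine (add_le_add_left (mem_epi.1 hmem) _).trans ?_
    exact_mod_cast (by linarith : m - h x + h x ≤ m)
  refine h5.trans ?_
  by_cases hz : φ z = ⊤
  · simp [hz]
  · obtain ⟨r, hr⟩ := hφ.exists_real hz
    have := hle z r (mem_epi.2 hr.le)
    simp only [hr]
    exact_mod_cast this

lemma existsUnique_argmin {φ : H → EReal} (hφ : IsGammaZero φ) {h : H → ℝ} {A : H → H} {α : ℝ}
    (hα : 0 < α) (hh : ∀ x, HasGradientAt h (A x) x) (hA : StrongMonoWith α A) :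
    ∃! x, x ∈ argmin (fun x => φ x + (h x : EReal)) := by
  obtain ⟨x, hx⟩ := argmin_nonempty hφ hα hh hA
  exact ⟨x, hx, fun z hz => argmin_unique hφ hα hh hA hz hx⟩

end Minimizers

end ParamConvex

namespace ParamConvex

/-! ### Weak limits and stability of variational inequalities. -/

section WeakConvergence

variable {H : Type*} [NormedAddCommGroup H] [InnerProductSpace ℝ H]

lemma weakTendsto_iff {E : Type*} [NormedAddCommGroup E] [NormedSpace ℝ E] {u : ℕ → E} {x : E} :
    WeakTendsto u x ↔ ∀ φ : E →L[ℝ] ℝ, Tendsto (fun n => φ (u n)) atTop (𝓝 (φ x)) :=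
  WeakBilin.tendsto_iff_forall_eval_tendsto _ (by
    intro a b hab
    have h : ∀ φ : E →L[ℝ] ℝ, φ a = φ b := fun φ => LinearMap.congr_fun hab φ
    exact (SeparatingDual.eq_iff_forall_dual_eq (R := ℝ)).2 h)

/-- Strong against weak convergence: boundedness of `u` kills the error term `⟨e n - a, u n⟩`. -/
lemma inner_tendsto_of_weak {e u : ℕ → H} {a x : H} {C : ℝ} (he : Tendsto e atTop (𝓝 a))
    (hC : ∀ n, ‖u n‖ ≤ C)
    (hu : ∀ y, Tendsto (fun n => (inner ℝ (u n) y : ℝ)) atTop (𝓝 (inner ℝ x y))) :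
    Tendsto (fun n => (inner ℝ (e n) (u n) : ℝ)) atTop (𝓝 (inner ℝ a x)) := by
  have h1 : Tendsto (fun n => (inner ℝ (e n - a) (u n) : ℝ)) atTop (𝓝 0) := by
    have h0 : Tendsto (fun n => ‖e n - a‖ * C) atTop (𝓝 0) := by
      simpa using (tendsto_iff_norm_sub_tendsto_zero.1 he).mul_const C
    refine squeeze_zero_norm (fun n => ?_) h0
    exact (norm_inner_le_norm _ _).trans (mul_le_mul_of_nonneg_left (hC n) (norm_nonneg _))
  have h2 := h1.add (hu a)
  rw [zero_add, real_inner_comm] at h2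
  refine h2.congr fun n => ?_
  rw [inner_sub_left, real_inner_comm a (u n)]
  ring

variable [CompleteSpace H]

/-- Weak convergence in `H × ℝ`. -/
lemma weakTendsto_prod {u : ℕ → H} {r : ℕ → ℝ} {x : H} {a : ℝ}
    (hu : ∀ y, Tendsto (fun n => (inner ℝ (u n) y : ℝ)) atTop (𝓝 (inner ℝ x y)))
    (hr : Tendsto r atTop (𝓝 a)) : WeakTendsto (fun n => (u n, r n)) (x, a) := by
  rw [weakTendsto_iff]
  intro φ
  have hdec : ∀ z s, φ (z, s) =
      inner ℝ z ((InnerProductSpace.toDual ℝ H).symm (φ.comp (.inl ℝ H ℝ))) +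
        (φ.comp (.inr ℝ H ℝ)) s := by
    intro z s
    rw [real_inner_comm, InnerProductSpace.toDual_symm_apply]
    simp only [ContinuousLinearMap.comp_apply, ContinuousLinearMap.inl_apply,
      ContinuousLinearMap.inr_apply]
    rw [← map_add]
    simp
  simp only [hdec]
  exact (hu _).add (((φ.comp (.inr ℝ H ℝ)).continuous.tendsto a).comp hr)

/-- A bounded sequence of a Hilbert space has a weakly convergent subsequence. -/
lemma exists_subseq_inner_tendsto {u : ℕ → H} {C : ℝ} (hu : ∀ n, ‖u n‖ ≤ C) :
    ∃ (x : H) (ψ : ℕ → ℕ), StrictMono ψ ∧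
      ∀ y, Tendsto (fun n => (inner ℝ (u (ψ n)) y : ℝ)) atTop (𝓝 (inner ℝ x y)) := by
  -- The closed span is separable, so sequential Banach–Alaoglu applies there; test vectors outside
  -- it are replaced by their projections.
  set K : Submodule ℝ H := (Submodule.span ℝ (range u)).topologicalClosure with hK
  have hmem : ∀ n, u n ∈ K := fun n =>
    Submodule.le_topologicalClosure _ (Submodule.subset_span (mem_range_self n))
  have hKc : IsClosed (K : Set H) := Submodule.isClosed_topologicalClosure _
  have : CompleteSpace K := hKc.completeSpace_coe
  have hsep : TopologicalSpace.IsSeparable (K : Set H) := by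
    rw [hK, Submodule.topologicalClosure_coe]
    exact ((countable_range u).isSeparable.span (R := ℝ)).closure
  have : TopologicalSpace.SeparableSpace K := hsep.separableSpace
  set v : ℕ → K := fun n => ⟨u n, hmem n⟩ with hv
  set d : ℕ → WeakDual ℝ K := fun n =>
    StrongDual.toWeakDual (InnerProductSpace.toDual ℝ K (v n)) with hd
  obtain ⟨x', -, ψ, hψ, hlim⟩ := WeakDual.isSeqCompact_closedBall ℝ K 0 C (x := d) (by
    intro n
    simp only [mem_preimage, mem_closedBall_zero_iff, hd]
    change ‖InnerProductSpace.toDual ℝ K (v n)‖ ≤ C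
    rw [LinearIsometryEquiv.norm_map]
    exact hu n)
  rw [tendsto_iff_forall_eval_tendsto_topDualPairing] at hlim
  set k : K := (InnerProductSpace.toDual ℝ K).symm (WeakDual.toStrongDual x') with hk
  refine ⟨k, ψ, hψ, fun y => ?_⟩
  have h1 := hlim (K.orthogonalProjectionOnto y)
  have h2 : ∀ z : K, (inner ℝ (z : H) y : ℝ) = inner ℝ z (K.orthogonalProjectionOnto y) := by
    intro z
    rw [Submodule.inner_orthogonalProjectionOnto_eq_of_mem_left]
  have h3 : (topDualPairing ℝ K) x' (K.orthogonalProjectionOnto y) = inner ℝ (k : H) y := by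
    rw [h2, hk, InnerProductSpace.toDual_symm_apply]
    rfl
  rw [h3] at h1
  refine h1.congr fun n => ?_
  change inner ℝ (v (ψ n)) (K.orthogonalProjectionOnto y) = _
  rw [← h2]

/-- Convergence of solutions of variational inequalities under Mosco convergence: `(w n, q n)`
solves the inequality governed by the strongly monotone map `A n` on the convex set `S (t n)`, and
`(w₀, q₀)` the one governed by `a` at `w₀` on the Mosco limit. -/
lemma tendsto_of_moscoConvergent {S : ℝ → Set (H × ℝ)} (hS : MoscoConvergent S)
    (hconv : ∀ τ, 0 < τ → Convex ℝ (S τ))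
    (hup : ∀ τ, 0 < τ → ∀ x r s, (x, r) ∈ S τ → r ≤ s → (x, s) ∈ S τ)
    {t : ℕ → ℝ} (ht : PosTendstoZero t) {α : ℝ} (hα : 0 < α) {A : ℕ → H → H}
    (hA : ∀ n, StrongMonoWith α (A n)) {w : ℕ → H} {q : ℕ → ℝ}
    (hw : ∀ n, (w n, q n) ∈ S (t n))
    (hVI : ∀ n z r, (z, r) ∈ S (t n) → q n - inner ℝ (A n (w n)) (z - w n) ≤ r)
    {w₀ a : H} {q₀ : ℝ} (hw₀ : (w₀, q₀) ∈ innerLimit S)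
    (hVI₀ : ∀ z r, (z, r) ∈ innerLimit S → q₀ - inner ℝ a (z - w₀) ≤ r)
    (hlim : ∀ u : ℕ → H, Tendsto u atTop (𝓝 w₀) → Tendsto (fun n => A n (u n)) atTop (𝓝 a)) :
    Tendsto w atTop (𝓝 w₀) := by
  obtain ⟨U, hU, N, hUS⟩ := hw₀ t ht
  set u : ℕ → H := fun n => (U n).1 with hu
  set r : ℕ → ℝ := fun n => (U n).2 with hr
  have hulim : Tendsto u atTop (𝓝 w₀) := (continuous_fst.tendsto _).comp hU
  have hrlim : Tendsto r atTop (𝓝 q₀) := (continuous_snd.tendsto _).comp hU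
  have hsub : Tendsto (fun n => w n - u n) atTop (𝓝 0) := by
    by_contra hnot
    rw [Metric.tendsto_nhds] at hnot
    push Not at hnot
    obtain ⟨ε, hε, hfreq⟩ := hnot
    set δ := min ε 1 with hδ
    have hδ0 : 0 < δ := lt_min hε one_pos
    obtain ⟨κ, hκ, hκS⟩ := extraction_of_frequently_atTop
      (hfreq.and_eventually (eventually_ge_atTop N))
    set d : ℕ → ℝ := fun n => ‖w (κ n) - u (κ n)‖ with hd
    have hdδ : ∀ n, δ ≤ d n := fun n => by
      have h1 := (hκS n).1
      rw [dist_zero_right] at h1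
      exact (min_le_left _ _).trans (by simpa using h1)
    -- Truncation: the step `s n • (w - u)` has norm between `δ` and `1`, however large `w - u` is.
    set s : ℕ → ℝ := fun n => min 1 (d n)⁻¹ with hs
    have hdpos : ∀ n, 0 < d n := fun n => hδ0.trans_le (hdδ n)
    have hs0 : ∀ n, 0 ≤ s n := fun n => le_min zero_le_one (inv_nonneg.2 (hdpos n).le)
    have hsd : ∀ n, s n * d n ≤ 1 := fun n => by
      calc s n * d n ≤ (d n)⁻¹ * d n :=
            mul_le_mul_of_nonneg_right (min_le_right _ _) (hdpos n).le
        _ = 1 := inv_mul_cancel₀ (hdpos n).ne'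
    have hsd2 : ∀ n, δ ^ 2 ≤ s n * d n ^ 2 := fun n => by
      have h1 : δ ≤ s n * d n := by
        rw [hs]
        simp only
        rw [min_mul_of_nonneg _ _ (hdpos n).le, one_mul, inv_mul_cancel₀ (hdpos n).ne']
        exact le_min (hdδ n) (min_le_right _ _)
      nlinarith [hdδ n]
    set e : ℕ → H := fun n => A (κ n) (u (κ n)) with he
    have helim : Tendsto e atTop (𝓝 a) := (hlim u hulim).comp hκ.tendsto_atTop
    set m : ℕ → H := fun n => s n • (w (κ n) - u (κ n)) with hm
    have hmn : ∀ n, ‖m n‖ ≤ 1 := fun n => by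
      rw [hm]
      simp only [norm_smul, Real.norm_eq_abs, abs_of_nonneg (hs0 n)]
      exact hsd n
    have hmem : ∀ n, (u (κ n) + m n, r (κ n) - inner ℝ (e n) (m n) - α * δ ^ 2) ∈ S (t (κ n)) := by
      intro n
      have h1 := convex_epi_combo (hconv _ (ht.1 (κ n))) (hUS _ (hκS n).2) (hw (κ n)) (hs0 n)
        (min_le_left _ _)
      refine hup _ (ht.1 _) _ _ _ h1 ?_
      have h2 := hVI (κ n) (u (κ n)) (r (κ n)) (hUS _ (hκS n).2)
      have h3 := hA (κ n) (u (κ n)) (w (κ n))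
      rw [inner_sub_left] at h3
      rw [← neg_sub (w (κ n)) (u (κ n)), inner_neg_right] at h2
      -- The inequality at `w`, tested at `u`, with `A w` traded for `A u` at the gain `α * d n ^
      -- 2`.
      have h4 : q (κ n) ≤ r (κ n) - inner ℝ (e n) (w (κ n) - u (κ n)) - α * d n ^ 2 := by
        simp only [he, hd]
        linarith
      have h5 := mul_le_mul_of_nonneg_left h4 (hs0 n)
      have h6 := mul_le_mul_of_nonneg_left (hsd2 n) hα.le
      have h7 : (inner ℝ (e n) (m n) : ℝ) = s n * inner ℝ (e n) (w (κ n) - u (κ n)) := by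
        rw [hm, inner_smul_right]
      rw [h7]
      change (1 - s n) * r (κ n) + s n * q (κ n) ≤ _
      linarith
    obtain ⟨m₀, ψ, hψ, hmlim⟩ := exists_subseq_inner_tendsto hmn
    have hκψ : Tendsto (fun n => κ (ψ n)) atTop atTop :=
      hκ.tendsto_atTop.comp hψ.tendsto_atTop
    -- The weak limit lies in the Mosco limit, yet is below the bound of `hVI₀` by `α * δ ^ 2`.
    have hin := hS (a := (w₀ + m₀, q₀ - inner ℝ a m₀ - α * δ ^ 2))
      ⟨fun n => t (κ (ψ n)), ⟨fun n => ht.1 _, ht.2.comp hκψ⟩, _, weakTendsto_prod ?_ ?_,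
        fun n => hmem (ψ n)⟩
    · have h8 := hVI₀ _ _ hin
      rw [add_sub_cancel_left] at h8
      have : 0 < α * δ ^ 2 := by positivity
      linarith
    · intro y
      simp only [inner_add_left]
      exact ((hulim.comp hκψ).inner tendsto_const_nhds).add (hmlim y)
    · exact ((hrlim.comp hκψ).sub (inner_tendsto_of_weak (helim.comp hψ.tendsto_atTop)
        (fun n => hmn (ψ n)) hmlim)).sub_const _
  simpa using hsub.add hulim

end WeakConvergence

end ParamConvex

namespace ParamConvex

/-! ### Rescaling, linearisation and the derivative of the solution. -/

section Sensitivity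

variable {H : Type*} [NormedAddCommGroup H] [InnerProductSpace ℝ H]

/-- Clearing denominators exhibits the epigraph as an affine preimage of `epi (f τ)`; convexity and
the variational inequality transfer through it. -/
lemma mem_epi_secondQuotient {f : ℝ → H → EReal} {x v : H} {τ c : ℝ} (hτ : 0 < τ)
    (hc : f τ x = c) (hbot : ∀ z, f τ z ≠ ⊥) {w : H} {r : ℝ} :
    (w, r) ∈ epi (secondQuotient f x v τ) ↔
      (x + τ • w, τ ^ 2 * r + c + τ * inner ℝ v w) ∈ epi (f τ) := by
  have hτ2 : 0 < τ ^ 2 := by positivity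
  rw [mem_epi, mem_epi, secondQuotient, hc]
  by_cases htop : f τ (x + τ • w) = ⊤
  · rw [htop, EReal.top_sub_coe, EReal.top_sub_coe,
      EReal.top_div_of_pos_ne_top (by exact_mod_cast hτ2) (EReal.coe_ne_top _)]
    simp only [top_le_iff, EReal.coe_ne_top]
  · obtain ⟨b, hb⟩ : ∃ b : ℝ, f τ (x + τ • w) = b :=
      ⟨_, (EReal.coe_toReal htop (hbot _)).symm⟩
    rw [hb, ← EReal.coe_sub, ← EReal.coe_sub, ← EReal.coe_div, EReal.coe_le_coe_iff,
      EReal.coe_le_coe_iff, div_le_iff₀ hτ2]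
    constructor <;> intro h <;> linarith

lemma convex_epi_secondQuotient {f : ℝ → H → EReal} {x v : H} {τ c : ℝ} (hτ : 0 < τ)
    (hc : f τ x = c) (hf : IsGammaZero (f τ)) : Convex ℝ (epi (secondQuotient f x v τ)) := by
  rintro ⟨w₁, r₁⟩ h₁ ⟨w₂, r₂⟩ h₂ a b ha hb hab
  rw [mem_epi_secondQuotient hτ hc hf.ne_bot] at h₁ h₂
  rw [Prod.smul_mk, Prod.smul_mk, Prod.mk_add_mk, mem_epi_secondQuotient hτ hc hf.ne_bot]
  have h := hf.convex h₁ h₂ ha hb hab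
  rw [Prod.smul_mk, Prod.smul_mk, Prod.mk_add_mk] at h
  obtain rfl : b = 1 - a := by linarith
  convert h using 2
  · module
  · simp only [smul_eq_mul, inner_add_right, inner_smul_right]
    ring

/-- Sequential criterion for right differentiability at `0`. -/
lemma hasDerivWithinAt_Ici_of_seq {E : Type*} [NormedAddCommGroup E] [NormedSpace ℝ E]
    {y : ℝ → E} {w : E}
    (h : ∀ t, PosTendstoZero t → Tendsto (fun n => (t n)⁻¹ • (y (t n) - y 0)) atTop (𝓝 w)) :
    HasDerivWithinAt y w (Ici 0) 0 := by
  rw [hasDerivWithinAt_iff_tendsto_slope, Ici_sdiff_left]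
  refine tendsto_of_seq_tendsto fun t ht => ?_
  rw [tendsto_nhdsWithin_iff] at ht
  -- The sequence is only eventually positive; shifting by `N` makes all its terms positive.
  obtain ⟨N, hN⟩ := eventually_atTop.1 ht.2
  rw [← tendsto_add_atTop_iff_nat N]
  refine (h (fun n => t (n + N)) ⟨fun n => hN _ (Nat.le_add_left _ _),
    (tendsto_add_atTop_iff_nat N).2 ht.1⟩).congr fun n => ?_
  simp [slope_def_module]

lemma mem_subdifferential_of_epi {f : H → EReal} (hf : IsGammaZero f) {x v : H} {a : ℝ}
    (ha : f x = a) (h : ∀ z r, (z, r) ∈ epi f → a + inner ℝ v (z - x) ≤ r) :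
    v ∈ subdifferential f x := by
  intro z
  by_cases hz : f z = ⊤
  · rw [hz, ha, EReal.top_sub_coe]
    exact le_top
  · obtain ⟨r, hr⟩ := hf.exists_real hz
    rw [hr, ha, ← EReal.coe_sub, EReal.coe_le_coe_iff]
    linarith [h z r (mem_epi.2 hr.le)]

lemma StrongMonoWith.sub_const {A : H → H} {α : ℝ} (hA : StrongMonoWith α A) (b : H) :
    StrongMonoWith α (fun x => A x - b) := by
  intro x₁ x₂
  simpa using hA x₁ x₂

/-- The derivative of a strongly monotone map is strongly monotone. -/
lemma StrongMonoWith.fderiv {A : H → H} {α : ℝ} (hA : StrongMonoWith α A) {D : H →L[ℝ] H} {x : H}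
    (hD : HasFDerivAt A D x) (b : H) : StrongMonoWith α (fun z => D z + b) := by
  intro x₁ x₂
  rw [add_sub_add_right_eq_sub, ← map_sub]
  set d := x₂ - x₁
  have h1 : HasDerivAt (fun s : ℝ => x + s • d) d 0 := by
    simpa using ((hasDerivAt_id (0 : ℝ)).smul_const d).const_add x
  have h2 : HasDerivAt (fun s : ℝ => A (x + s • d)) (D d) 0 :=
    HasFDerivAt.comp_hasDerivAt (0 : ℝ) (by simpa using hD) h1
  have h3 := h2.tendsto_slope_zero_right.inner (𝕜 := ℝ) (tendsto_const_nhds (x := d))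
  refine ge_of_tendsto h3 ?_
  filter_upwards [self_mem_nhdsWithin] with s hs
  have hs : 0 < s := hs
  have h4 := hA x (x + s • d)
  rw [add_sub_cancel_left, norm_smul, inner_smul_right, mul_pow, Real.norm_eq_abs, sq_abs] at h4
  simp only [zero_add, zero_smul, add_zero]
  rw [real_inner_smul_left, inv_mul_eq_div, le_div_iff₀ hs]
  refine le_of_mul_le_mul_left ?_ hs
  linarith

variable [CompleteSpace H]

/-- Right differentiability at `0` of the solutions `y t` of the variational inequalities governed
by `G t - ℓ t` and `f t`; the derivative solves the linearized variational inequality. -/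
lemma hasDerivWithinAt_solution {f : ℝ → H → EReal} {G : ℝ → H → H} {ℓ y : ℝ → H} {α : ℝ}
    (hα : 0 < α) (hf : ∀ t, 0 ≤ t → IsGammaZero (f t))
    (hG : ∀ t, 0 ≤ t → StrongMonoWith α (G t))
    (hy : ∀ t, 0 ≤ t → ∃ a : ℝ, f t (y t) = a ∧
      ∀ z r, (z, r) ∈ epi (f t) → a - inner ℝ (G t (y t) - ℓ t) (z - y t) ≤ r)
    {ℓ' : H} (hℓ : HasDerivWithinAt ℓ ℓ' (Ici 0) 0) {L : ℝ × H →L[ℝ] H}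
    (hL : HasFDerivWithinAt (fun p : ℝ × H => G p.1 p.2) L (Ici 0 ×ˢ univ) (0, y 0))
    {v : H} (hv : v = ℓ 0 - G 0 (y 0)) (hepi : TwiceEpiDifferentiableAt f (y 0) v)
    {w₀ : H} {q₀ : ℝ} (hq₀ : secondEpiDeriv f (y 0) v w₀ = q₀)
    (hw₀ : ∀ z r, (z, r) ∈ epi (secondEpiDeriv f (y 0) v) →
      q₀ - inner ℝ (L (1, w₀) - ℓ') (z - w₀) ≤ r) :
    HasDerivWithinAt y w₀ (Ici 0) 0 := by
  refine hasDerivWithinAt_Ici_of_seq fun t ht => ?_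
  have hbot : ∀ τ, 0 < τ → ∀ z, f τ z ≠ ⊥ := fun τ hτ => (hf τ hτ.le).ne_bot
  have hc : ∀ τ, ∃ c : ℝ, 0 < τ → f τ (y 0) = c := fun τ =>
    ⟨(f τ (y 0)).toReal, fun hτ =>
      (EReal.coe_toReal (hepi.finite τ hτ.le).2 (hepi.finite τ hτ.le).1).symm⟩
  choose c hc using hc
  have hyt : ∀ n, ∃ a : ℝ, f (t n) (y (t n)) = a ∧ ∀ z r, (z, r) ∈ epi (f (t n)) →
      a - inner ℝ (G (t n) (y (t n)) - ℓ (t n)) (z - y (t n)) ≤ r := fun n => hy _ (ht.1 n).le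
  choose a ha hVI using hyt
  set w : ℕ → H := fun n => (t n)⁻¹ • (y (t n) - y 0) with hw
  have hyw : ∀ n, y 0 + t n • w n = y (t n) := fun n => by
    rw [hw]
    simp only
    rw [smul_inv_smul₀ (ht.1 n).ne']
    abel
  have hepiL : innerLimit (fun τ => epi (secondQuotient f (y 0) v τ)) =
      epi (secondEpiDeriv f (y 0) v) := (epi_epiLimit _).symm
  -- Here `q n` is the value of the quotient at `w n`, and `v` enters the map because the quotient
  -- subtracts `τ * ⟨v, w⟩`.
  refine tendsto_of_moscoConvergent (a := L (1, w₀) - ℓ') (q₀ := q₀)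
    (A := fun n x => (t n)⁻¹ • (G (t n) (y 0 + t n • x) + v - ℓ (t n)))
    (q := fun n => (a n - c (t n) - t n * inner ℝ v (w n)) / t n ^ 2)
    hepi.mconvergent (fun τ hτ => convex_epi_secondQuotient hτ (hc τ hτ) (hf τ hτ.le))
    (fun τ _ x r s h hrs => epi_mono h hrs) ht hα ?_ ?_ ?_ ?_ ?_ ?_
  · intro n x₁ x₂
    have hτ := ht.1 n
    have h1 := hG (t n) hτ.le (y 0 + t n • x₁) (y 0 + t n • x₂)
    rw [add_sub_add_left_eq_sub, ← smul_sub, norm_smul, inner_smul_right, mul_pow,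
      Real.norm_eq_abs, sq_abs] at h1
    rw [← smul_sub, real_inner_smul_left, inv_mul_eq_div, le_div_iff₀ hτ]
    rw [show G (t n) (y 0 + t n • x₂) + v - ℓ (t n) - (G (t n) (y 0 + t n • x₁) + v - ℓ (t n)) =
      G (t n) (y 0 + t n • x₂) - G (t n) (y 0 + t n • x₁) by abel]
    refine le_of_mul_le_mul_left ?_ hτ
    linarith
  · intro n
    have hτ := ht.1 n
    rw [mem_epi_secondQuotient hτ (hc _ hτ) (hbot _ hτ), hyw, mem_epi, ha, EReal.coe_le_coe_iff,
      mul_div_cancel₀ _ (by positivity)]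
    linarith
  · intro n z r hz
    have hτ := ht.1 n
    rw [mem_epi_secondQuotient hτ (hc _ hτ) (hbot _ hτ)] at hz
    have h1 := hVI n _ _ hz
    have h2 : y 0 + t n • z - y (t n) = t n • (z - w n) := by
      rw [← hyw n]
      module
    rw [h2, inner_smul_right] at h1
    simp only [hyw]
    rw [real_inner_smul_left, add_sub_right_comm, inner_add_left]
    have h3 : t n ^ 2 * ((a n - c (t n) - t n * inner ℝ v (w n)) / t n ^ 2 -
        (t n)⁻¹ * (inner ℝ (G (t n) (y (t n)) - ℓ (t n)) (z - w n) + inner ℝ v (z - w n))) =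
        a n - c (t n) - t n * inner ℝ v (w n) -
          t n * (inner ℝ (G (t n) (y (t n)) - ℓ (t n)) (z - w n) + inner ℝ v (z - w n)) := by
      field_simp
    refine le_of_mul_le_mul_left ?_ (show 0 < t n ^ 2 by positivity)
    rw [h3, inner_sub_right v z]
    linarith
  · rw [hepiL, mem_epi, hq₀]
  · rw [hepiL]
    exact hw₀
  · intro u hu
    have htu : Tendsto (fun n => t n • u n) atTop (𝓝 0) := by
      simpa using ht.2.smul hu
    -- As `v = ℓ 0 - G 0 (y 0)`, the rescaled map is a difference of two difference quotients, that
    -- of `G` taken along `(1, u n) → (1, w₀)`.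
    have h1 := hL.lim (l := atTop) (c := fun n => (t n)⁻¹) (d := fun n => (t n, t n • u n))
      (v := (1, w₀)) (ht.2.prodMk_nhds htu)
      (Eventually.of_forall fun n => by simpa using (ht.1 n).le)
      (by
        refine (tendsto_const_nhds.prodMk_nhds hu).congr fun n => ?_
        rw [Prod.smul_mk, inv_smul_smul₀ (ht.1 n).ne', smul_eq_mul, inv_mul_cancel₀ (ht.1 n).ne'])
    have h2 := hℓ.hasFDerivWithinAt.lim (l := atTop) (c := fun n => (t n)⁻¹) (d := t) (v := 1)
      ht.2 (Eventually.of_forall fun n => by simpa using (ht.1 n).le)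
      (tendsto_const_nhds.congr fun n => by
        rw [smul_eq_mul, inv_mul_cancel₀ (ht.1 n).ne'])
    have h3 := h1.sub h2
    simp only [Prod.mk_add_mk, zero_add, ContinuousLinearMap.toSpanSingleton_apply, one_smul] at h3
    refine h3.congr fun n => ?_
    rw [hv]
    module

/-- The derivative of a gradient is symmetric. -/
lemma inner_fderiv_gradient_comm {h : H → ℝ} (hh : Differentiable ℝ h) {D : H →L[ℝ] H} {x : H}
    (hD : HasFDerivAt (gradient h) D x) (z w : H) : inner ℝ (D z) w = inner ℝ (D w) z := by
  have h1 : HasFDerivAt (fun p => InnerProductSpace.toDual ℝ H (gradient h p))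
      ((InnerProductSpace.toDual ℝ H).toContinuousLinearEquiv.toContinuousLinearMap.comp D) x :=
    (InnerProductSpace.toDual ℝ H).toContinuousLinearEquiv.toContinuousLinearMap.hasFDerivAt.comp
      x hD
  exact second_derivative_symmetric (fun p => (hh p).hasGradientAt.hasFDerivAt) h1 z w

/-- In general the quadratic part has gradient `(D + D*) x / 2`; symmetry reduces it to `D x`. -/
lemma hasGradientAt_quadratic {D : H →L[ℝ] H} (hD : ∀ z w, inner ℝ (D z) w = inner ℝ (D w) z)
    (b x : H) :
    HasGradientAt (fun x => (1 / 2 * inner ℝ (D x) x + inner ℝ b x : ℝ)) (D x + b) x := by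
  rw [hasGradientAt_iff_hasFDerivAt]
  have h1 := ((D.hasFDerivAt (x := x)).inner ℝ (hasFDerivAt_id x)).const_mul (1 / 2)
  have h2 := (hasFDerivAt_const b x).inner ℝ (hasFDerivAt_id x)
  refine (h1.add h2).congr_fderiv ?_
  ext z
  simp [fderivInnerCLM_apply, hD z x]
  ring

lemma hasGradientAt_sub_inner {h : H → ℝ} (hh : Differentiable ℝ h) (b x : H) :
    HasGradientAt (fun x => h x - inner ℝ b x) (gradient h x - b) x := by
  rw [hasGradientAt_iff_hasFDerivAt, map_sub]
  exact (hh x).hasGradientAt.hasFDerivAt.sub (InnerProductSpace.toDual ℝ H b).hasFDerivAt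

end Sensitivity

end ParamConvex

theorem mainTheorem5 {H : Type*} [NormedAddCommGroup H] [InnerProductSpace ℝ H] [CompleteSpace H]
    (f : ℝ → H → EReal) (g : ℝ → H → ℝ) (ℓ : ℝ → H)
    (hf : ∀ t, 0 ≤ t → IsGammaZero (f t))
    (hg : ∀ t, 0 ≤ t → Differentiable ℝ (g t))
    (hgA : ∀ t, 0 ≤ t → IsLipStrongMono (gradient (g t))) :
    (∀ t, 0 ≤ t → ∃! x : H, x ∈ argmin (fun x => f t x + ((g t x - inner ℝ (ℓ t) x : ℝ) : EReal))) ∧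
    ∀ y : ℝ → H,
      (∀ t, 0 ≤ t →
        y t ∈ argmin (fun x => f t x + ((g t x - inner ℝ (ℓ t) x : ℝ) : EReal))) →
      ∀ v₀ : H, v₀ = ℓ 0 - gradient (g 0) (y 0) →
      v₀ ∈ subdifferential (f 0) (y 0) ∧
      (DifferentiableWithinAt ℝ ℓ (Ici 0) 0 →
        IsUnifLipStrongMono (fun t => gradient (g t)) →
        ContDiffOn ℝ 1 (fun p : ℝ × H => gradient (g p.1) p.2) (Ici 0 ×ˢ univ) →
        TwiceEpiDifferentiableAt f (y 0) v₀ →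
        IsGammaZero (secondEpiDeriv f (y 0) v₀) →
        DifferentiableWithinAt ℝ y (Ici 0) 0 ∧
        argmin (fun x => secondEpiDeriv f (y 0) v₀ x +
          ((1 / 2 * inner ℝ (fderiv ℝ (gradient (g 0)) (y 0) x) x +
            inner ℝ (derivWithin (fun t => gradient (g t) (y 0)) (Ici 0) 0
              - derivWithin ℓ (Ici 0) 0) x : ℝ) : EReal)) =
          {derivWithin y (Ici 0) 0}) := by
  have hgrad : ∀ t, 0 ≤ t → ∀ x, HasGradientAt (fun x => g t x - inner ℝ (ℓ t) x)
      (gradient (g t) x - ℓ t) x := fun t ht => hasGradientAt_sub_inner (hg t ht) (ℓ t)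
  refine ⟨fun t ht => ?_, fun y hy v₀ hv₀ => ?_⟩
  · obtain ⟨-, α, hα, hmono⟩ := hgA t ht
    exact existsUnique_argmin (hf t ht) hα (hgrad t ht) (StrongMonoWith.sub_const hmono (ℓ t))
  have hVI : ∀ t, 0 ≤ t → ∃ a : ℝ, f t (y t) = a ∧ ∀ z r, (z, r) ∈ epi (f t) →
      a - inner ℝ (gradient (g t) (y t) - ℓ t) (z - y t) ≤ r := fun t ht =>
    argmin_variational (hf t ht) (hgrad t ht) (hy t ht)
  refine ⟨?_, fun hℓ hgu hC1 hepi hΓ => ?_⟩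
  · obtain ⟨a, ha, h⟩ := hVI 0 le_rfl
    refine mem_subdifferential_of_epi (hf 0 le_rfl) ha fun z r hz => ?_
    have h1 := h z r hz
    rw [← neg_sub (ℓ 0), ← hv₀, inner_neg_left] at h1
    linarith
  obtain ⟨-, α, hα, hmono⟩ := hgu
  have hmem : ((0 : ℝ), y 0) ∈ (Ici (0 : ℝ) ×ˢ (univ : Set H)) := by simp
  obtain ⟨L, hL⟩ := (hC1.differentiableOn one_ne_zero) _ hmem
  -- The slice `t = 0` lies wholly in the domain, so the derivative in `x` is unrestricted; the one
  -- in `t` is only a right derivative.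
  have hD : HasFDerivAt (gradient (g 0)) (L.comp (.inr ℝ ℝ H)) (y 0) := by
    rw [← hasFDerivWithinAt_univ]
    exact hL.comp (y 0) (hasFDerivAt_prodMk_right (0 : ℝ) (y 0)).hasFDerivWithinAt
      (fun x _ => by simp)
  have ht : HasDerivWithinAt (fun t => gradient (g t) (y 0)) (L (1, 0)) (Ici 0) 0 := by
    have h1 := hL.comp (f := fun t : ℝ => (t, y 0)) (s := Ici 0) (0 : ℝ)
      (hasFDerivAt_prodMk_left (0 : ℝ) (y 0)).hasFDerivWithinAt (fun s hs => ⟨hs, mem_univ _⟩)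
    exact h1.hasDerivWithinAt.congr_deriv (by simp)
  have huniq : UniqueDiffWithinAt ℝ (Ici (0 : ℝ)) 0 := uniqueDiffWithinAt_Ici 0
  rw [hD.fderiv, ht.derivWithin huniq]
  set D := L.comp (.inr ℝ ℝ H) with hDdef
  set b := L (1, 0) - derivWithin ℓ (Ici 0) 0 with hb
  have hsymm := inner_fderiv_gradient_comm (hg 0 le_rfl) hD
  obtain ⟨w₀, hw₀, hw₀u⟩ := existsUnique_argmin hΓ hα (hasGradientAt_quadratic hsymm b)
    (StrongMonoWith.fderiv (hmono 0 le_rfl) hD b)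
  obtain ⟨q₀, hq₀, hVI₀⟩ := argmin_variational hΓ (hasGradientAt_quadratic hsymm b) hw₀
  have hLw : L (1, w₀) - derivWithin ℓ (Ici 0) 0 = D w₀ + b := by
    have h1 : ((1 : ℝ), w₀) = (0, w₀) + (1, 0) := by simp
    rw [h1, map_add, hb, hDdef]
    simp only [ContinuousLinearMap.comp_apply, ContinuousLinearMap.inr_apply]
    abel
  have hder : HasDerivWithinAt y w₀ (Ici 0) 0 := by
    refine hasDerivWithinAt_solution hα hf hmono hVI hℓ.hasDerivWithinAt hL hv₀ hepi hq₀ ?_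
    rw [hLw]
    exact hVI₀
  refine ⟨hder.differentiableWithinAt, ?_⟩
  rw [hder.derivWithin huniq]
  exact Subset.antisymm (fun z hz => hw₀u z hz) (singleton_subset_iff.2 hw₀)
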